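/- Let $r,k\ge 1$ be integers and let $\Lambda_{rk}=\{(n,i,j)\in\mathbb{Z}^3 : 1\le i\le r,\ 1\le j\le k\}$. A solution of the truncated Zamolodchikov $Y$-system of type $A_k\times A_r$ is a map $Y:\Lambda_{rk}\to\mathbb{C}^*=\mathbb{C}\setminus\{0\}$ such that, for every $(n,i,j)\in\Lambda_{rk}$, $$Y(n-1,i,j)\,Y(n+1,i,j)=\frac{\bigl(1+Y(n,i-1,j)\bigr)\bigl(1+Y(n,i+1,j)\bigr)}{\bigl(1+1/Y(n,i,j+1)\bigr)\bigl(1+1/Y(n,i,j-1)\bigr)},$$ where every factor referring to a point outside $\Lambda_{rk}$ is omitted (that is, replaced by $1$), and where the equation includes the requirement that the denominator is nonzero. Then every solution satisfies $$Y(n,i,j)=Y(n+r+k+2,\;r+1-i,\;k+1-j)\qquad\text{for all }(n,i,j)\in\Lambda_{rk}.$$ Consequently every solution is periodic in $n$ with period $2(r+k+2)$: $Y(n+2(r+k+2),i,j)=Y(n,i,j)$ for all $(n,i,j)\in\Lambda_{rk}$. -/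

import Mathlib

namespace YSystem

/-- The truncated lattice: all `(n, i, j)` in `ℤ³` with `1 ≤ i ≤ r` and `1 ≤ j ≤ k`. -/
def truncatedLattice (r k : ℕ) : Set (ℤ × ℤ × ℤ) :=
  {m | (1 ≤ m.2.1 ∧ m.2.1 ≤ r) ∧ (1 ≤ m.2.2 ∧ m.2.2 ≤ k)}

/-- Membership in the truncated lattice does not depend on the first coordinate. -/
theorem truncatedLattice_change {r k : ℕ} {n i j : ℤ}
    (h : (n, i, j) ∈ truncatedLattice r k) (n' : ℤ) :
    (n', i, j) ∈ truncatedLattice r k := h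

theorem truncatedLattice_twist {r k : ℕ} {n i j : ℤ}
    (h : (n, i, j) ∈ truncatedLattice r k) (n' : ℤ) :
    (n', (r : ℤ) + 1 - i, (k : ℤ) + 1 - j) ∈ truncatedLattice r k := by
  simp only [truncatedLattice, Set.mem_ofPred_eq] at h ⊢
  omega

open Classical in
/-- The factor `1 + Y(m)`, omitted (that is, replaced by `1`) when `m` lies outside the
truncated lattice. -/
noncomputable def onePlus {r k : ℕ} (Y : truncatedLattice r k → ℂˣ) (m : ℤ × ℤ × ℤ) : ℂ :=
  if h : m ∈ truncatedLattice r k then 1 + (Y ⟨m, h⟩ : ℂ) else 1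

open Classical in
/-- The factor `1 + 1 / Y(m)`, omitted (that is, replaced by `1`) when `m` lies outside the
truncated lattice. -/
noncomputable def onePlusInv {r k : ℕ} (Y : truncatedLattice r k → ℂˣ) (m : ℤ × ℤ × ℤ) : ℂ :=
  if h : m ∈ truncatedLattice r k then 1 + 1 / (Y ⟨m, h⟩ : ℂ) else 1

/-- `Y` solves the truncated `Y`-system: the relation holds at every site of the truncated lattice.
The left-hand side is a product of nonzero numbers, so the equation can only hold
when the denominator on the right-hand side is nonzero. -/
def IsSolution {r k : ℕ} (Y : truncatedLattice r k → ℂˣ) : Prop :=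
  ∀ (n i j : ℤ) (h : (n, i, j) ∈ truncatedLattice r k),
    (Y ⟨(n - 1, i, j), truncatedLattice_change h (n - 1)⟩ : ℂ) *
        (Y ⟨(n + 1, i, j), truncatedLattice_change h (n + 1)⟩ : ℂ) =
      (onePlus Y (n, i - 1, j) * onePlus Y (n, i + 1, j)) /
        (onePlusInv Y (n, i, j + 1) * onePlusInv Y (n, i, j - 1))

end YSystem

namespace YSystem

open Matrix

section Determinants

variable {K : Type*} [Field K]

/-- Moving a row of a determinant to the top. -/
theorem det_eq_neg_one_pow_mul_det_cons {n : ℕ} (f : Fin (n + 1) → Fin (n + 1) → K)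
    (p : Fin (n + 1)) (x : Fin (n + 1) → K) (C : Fin n → Fin (n + 1) → K)
    (hx : f p = x) (hC : ∀ m, f (p.succAbove m) = C m) :
    Matrix.det (Matrix.of f) = (-1) ^ (p : ℕ) * Matrix.det (Matrix.of (Matrix.vecCons x C)) := by
  have h : f = p.insertNth x C := by
    rw [Fin.eq_insertNth_iff]
    exact ⟨hx, funext hC⟩
  have := (Matrix.detRowAlternating (n := Fin (n + 1)) (R := K)).map_insertNth p x C
  rw [zsmul_eq_mul] at this
  rw [h]
  exact_mod_cast this

/-- The three-term Plücker relation. -/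
theorem det_plucker {n : ℕ} (C : Fin n → Fin (n + 2) → K) (x y z w : Fin (n + 2) → K) :
    Matrix.det (Matrix.of (vecCons x (vecCons y C))) *
        Matrix.det (Matrix.of (vecCons z (vecCons w C))) =
      Matrix.det (Matrix.of (vecCons z (vecCons y C))) *
          Matrix.det (Matrix.of (vecCons x (vecCons w C))) +
        Matrix.det (Matrix.of (vecCons x (vecCons z C))) *
          Matrix.det (Matrix.of (vecCons y (vecCons w C))) := by
  set M : Matrix (Fin (n + 2)) (Fin (n + 2)) K := Matrix.of (vecCons x (vecCons y C))
  let g : (Fin (n + 2) → K) →ₗ[K] K :=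
    (Matrix.detRowAlternating (n := Fin (n + 2)) (R := K)).toMultilinearMap.toLinearMap
      (vecCons 0 (vecCons w C)) 0
  have hg : ∀ u, g u = Matrix.det (Matrix.of (vecCons u (vecCons w C))) := by
    intro u
    have : Function.update (vecCons (0 : Fin (n + 2) → K) (vecCons w C)) 0 u =
        vecCons u (vecCons w C) := by
      ext p
      refine Fin.cases ?_ (fun p => ?_) p <;> simp
    simp only [g, MultilinearMap.toLinearMap_apply, this]
    rfl
  have h1 : M.det • z = ∑ p, (M.updateRow p z).det • M p := by
    have := Matrix.mulVec_cramer Mᵀ z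
    rw [Matrix.det_transpose] at this
    rw [← this]
    ext q
    simp [Matrix.mulVec, dotProduct, Matrix.cramer_transpose_apply, mul_comm]
  have h2 := congrArg g h1
  rw [LinearMap.map_smul, map_sum, Fin.sum_univ_succ, Fin.sum_univ_succ] at h2
  rw [Finset.sum_eq_zero, add_zero] at h2
  · have e0 : M.updateRow 0 z = Matrix.of (vecCons z (vecCons y C)) := by
      ext p q
      refine Fin.cases ?_ (fun p => ?_) p <;> simp [M, Matrix.updateRow_apply]
    have e1 : M.updateRow (Fin.succ 0) z = Matrix.of (vecCons x (vecCons z C)) := by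
      ext p q
      refine Fin.cases ?_ (fun p => Fin.cases ?_ (fun p => ?_) p) p
      · simp [M, Matrix.updateRow_apply]
      · simp [M, Matrix.updateRow_apply]
      · simp [M, Matrix.updateRow_apply, Fin.ext_iff]
    rw [e0, e1] at h2
    simp only [LinearMap.map_smul, smul_eq_mul] at h2
    rw [hg, hg, hg] at h2
    exact h2
  · intro p _
    rw [LinearMap.map_smul, hg]
    apply smul_eq_zero_of_right
    refine Matrix.det_zero_of_row_eq (i := 0) (j := p.succ.succ) (by simp [Fin.ext_iff]) ?_
    ext q
    simp [M]

theorem det_cons_cons_swap {n : ℕ} (C : Fin n → Fin (n + 2) → K) (x y : Fin (n + 2) → K) :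
    Matrix.det (Matrix.of (vecCons x (vecCons y C))) =
      -Matrix.det (Matrix.of (vecCons y (vecCons x C))) := by
  rw [det_eq_neg_one_pow_mul_det_cons (vecCons x (vecCons y C)) 1 y (vecCons x C) (by simp)]
  · simp
  · intro m
    refine Fin.cases ?_ (fun m => ?_) m
    · simp
    · rw [← Fin.succ_zero_eq_one, Fin.succ_succAbove_succ]
      simp

/-- Moving two rows of a determinant to the top. -/
theorem det_eq_neg_one_pow_mul_det_cons_cons {n : ℕ} (f : Fin (n + 2) → Fin (n + 2) → K)
    (p : Fin (n + 2)) (q : Fin (n + 1)) (C : Fin n → Fin (n + 2) → K)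
    (hC : ∀ m, f (p.succAbove (q.succAbove m)) = C m) :
    Matrix.det (Matrix.of f) = (-1) ^ ((p : ℕ) + q) *
      Matrix.det (Matrix.of (vecCons (f p) (vecCons (f (p.succAbove q)) C))) := by
  rw [det_eq_neg_one_pow_mul_det_cons f p (f p) (fun m => f (p.succAbove m)) rfl fun _ => rfl,
    det_eq_neg_one_pow_mul_det_cons _ q.succ (f (p.succAbove q)) (vecCons (f p) C) (by simp),
    det_cons_cons_swap C (f p)]
  · simp only [Fin.val_succ, pow_add]
    ring
  · intro m
    refine Fin.cases ?_ (fun m => ?_) m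
    · simp
    · rw [Fin.succ_succAbove_succ]
      simp [hC]

/-- The determinant of `d` vectors of a sequence: `i` consecutive ones starting at `a`, then, after
a gap of length `j`, another `d - i` consecutive ones. -/
def blockDet {d : ℕ} (v : ℕ → Fin d → K) (a i j : ℕ) : K :=
  Matrix.det (Matrix.of fun p : Fin d => v (a + p + if (p : ℕ) < i then 0 else j))

theorem blockDet_congr {d : ℕ} {v w : ℕ → Fin d → K} {a i j a' i' j' : ℕ}
    (h : ∀ p < d, v (a + p + if p < i then 0 else j) = w (a' + p + if p < i' then 0 else j')) :
    blockDet v a i j = blockDet w a' i' j' := by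
  unfold blockDet
  congr 2
  funext p
  exact h p p.2

theorem blockDet_congr_left {d : ℕ} {v w : ℕ → Fin d → K} {a i j : ℕ}
    (h : ∀ m < a + d + j, v m = w m) : blockDet v a i j = blockDet w a i j := by
  refine blockDet_congr fun p hp => h _ ?_
  split_ifs <;> omega

/-- The discrete Hirota equation. -/
theorem blockDet_mul_blockDet {n : ℕ} (v : ℕ → Fin (n + 2) → K) (a j : ℕ) {i : ℕ}
    (hi : i < n + 1) :
    blockDet v a (i + 1) (j + 1) * blockDet v (a + 1) (i + 1) (j + 1) =
      blockDet v a (i + 2) (j + 1) * blockDet v (a + 1) i (j + 1) +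
        blockDet v a (i + 1) (j + 2) * blockDet v (a + 1) (i + 1) j := by
  let C : Fin n → Fin (n + 2) → K := fun m => v (a + 1 + m + if (m : ℕ) < i then 0 else j + 2)
  let G : ℕ → ℕ → K := fun s t => Matrix.det (Matrix.of (vecCons (v s) (vecCons (v t) C)))
  have key : ∀ (a' i' j' s t p q : ℕ) (hp : p < n + 2) (hq : q < n + 1),
      (a' + p + if p < i' then 0 else j') = s →
      (a' + (if q < p then q else q + 1) +
        if (if q < p then q else q + 1) < i' then 0 else j') = t →
      (∀ m < n, ∀ m' m'', (if m < q then m else m + 1) = m' →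
        (if m' < p then m' else m' + 1) = m'' →
        (a' + m'' + if m'' < i' then 0 else j') = a + 1 + m + if m < i then 0 else j + 2) →
      blockDet v a' i' j' = (-1) ^ (p + q) * G s t := by
    intro a' i' j' s t p q hp hq hs ht hC
    have val : ∀ {l : ℕ} (x : Fin (l + 1)) (y : Fin l),
        (x.succAbove y : ℕ) = if (y : ℕ) < x then (y : ℕ) else y + 1 := by
      intro l x y
      simp only [Fin.succAbove, Fin.lt_def, Fin.val_castSucc]
      split_ifs <;> simp
    unfold blockDet
    rw [det_eq_neg_one_pow_mul_det_cons_cons _ ⟨p, hp⟩ ⟨q, hq⟩ C]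
    · simp only [G, val, hs, ht]
    · intro m
      simp only [C]
      congr 1
      exact hC m m.2 ((⟨q, hq⟩ : Fin (n + 1)).succAbove m) _ (val ⟨q, hq⟩ m).symm
        (val ⟨p, hp⟩ _).symm
  rw [key a (i + 1) (j + 1) a (a + i + j + 2) 0 i (by omega) hi (by grind) (by grind) (by grind),
    key (a + 1) (i + 1) (j + 1) (a + n + j + 3) (a + i + 1) (n + 1) i (by omega) hi
      (by grind) (by grind) (by grind),
    key a (i + 2) (j + 1) a (a + i + 1) 0 i (by omega) hi (by grind) (by grind) (by grind),
    key (a + 1) i (j + 1) (a + n + j + 3) (a + i + j + 2) (n + 1) i (by omega) hi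
      (by grind) (by grind) (by grind),
    key a (i + 1) (j + 2) a (a + n + j + 3) 0 n (by omega) (by omega)
      (by grind) (by grind) (by grind),
    key (a + 1) (i + 1) j (a + i + 1) (a + i + j + 2) i i (by omega) hi
      (by grind) (by grind) (by grind)]
  have h := det_plucker C (v a) (v (a + i + 1)) (v (a + n + j + 3)) (v (a + i + j + 2))
  simp only [G, pow_add, pow_one, pow_zero]
  linear_combination ((-1) ^ i) ^ 2 * (-1) ^ n * h

theorem det_shift {n : ℕ} (u : ℕ → Fin (n + 1) → K) (h : u (n + 1) = (-1 : K) ^ n • u 0) :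
    Matrix.det (Matrix.of fun p : Fin (n + 1) => u p) =
      Matrix.det (Matrix.of fun p : Fin (n + 1) => u (p + 1)) := by
  rw [det_eq_neg_one_pow_mul_det_cons (fun p : Fin (n + 1) => u (p + 1)) (Fin.last n)
    (u (n + 1)) (fun m => u (m + 1)) (by simp) (by simp)]
  have e : Matrix.of (vecCons (u (n + 1)) fun m : Fin n => u (m + 1)) =
      (Matrix.of fun p : Fin (n + 1) => u p).updateRow 0 ((-1 : K) ^ n • u 0) := by
    ext p q
    refine Fin.cases ?_ (fun p => ?_) p <;> simp [h]
  have e' : (Matrix.of fun p : Fin (n + 1) => u p).updateRow 0 (u 0) =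
      Matrix.of fun p : Fin (n + 1) => u p := by
    ext p q
    refine Fin.cases ?_ (fun p => ?_) p <;> simp
  rw [e, Matrix.det_updateRow_smul, e', Fin.val_last, ← mul_assoc, ← pow_add, ← two_mul]
  simp

theorem det_shift_iterate {n : ℕ} (i : ℕ) (u : ℕ → Fin (n + 1) → K)
    (h : ∀ p < i, u (p + (n + 1)) = (-1 : K) ^ n • u p) :
    Matrix.det (Matrix.of fun p : Fin (n + 1) => u p) =
      Matrix.det (Matrix.of fun p : Fin (n + 1) => u (p + i)) := by
  induction i with
  | zero => rfl
  | succ i ih =>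
    rw [ih fun p hp => h p (by omega)]
    have := det_shift (fun p => u (p + i)) (by
      have := h i (by omega)
      simpa [add_comm, add_left_comm] using this)
    rw [this]
    simp [add_comm, add_left_comm]

/-- The half-periodicity of the block determinants of a quasi-periodic sequence of vectors. -/
theorem blockDet_twist {n k : ℕ} (v : ℕ → Fin (n + 1) → K)
    (hv : ∀ m, v (m + (n + k + 2)) = (-1 : K) ^ n • v m) (a : ℕ) {i i' j j' : ℕ}
    (hi : i + i' = n + 1) (hj : j + j' = k + 1) :
    blockDet v a i j = blockDet v (a + i + j) i' j' := by
  let u : ℕ → Fin (n + 1) → K := fun p =>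
    v (a + p + if p < i then 0 else if p < n + 1 then j else k + 1)
  have h := det_shift_iterate i u fun p hp => by
    simp only [u]
    rw [← hv]
    congr 1
    grind
  have e : blockDet v a i j = Matrix.det (Matrix.of fun p : Fin (n + 1) => u p) := by
    unfold blockDet
    congr 2
    funext p
    simp only [u]
    congr 1
    grind
  rw [e, h]
  unfold blockDet
  congr 2
  funext p
  simp only [u]
  congr 1
  grind

theorem blockDet_zero_left {d : ℕ} (v : ℕ → Fin d → K) (a j : ℕ) :
    blockDet v a 0 j = blockDet v (a + j) d 0 :=
  blockDet_congr fun p hp => by congr 1; grind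

theorem blockDet_full {d : ℕ} (v : ℕ → Fin d → K) (a j j' : ℕ) :
    blockDet v a d j = blockDet v a d j' :=
  blockDet_congr fun p hp => by congr 1; grind

theorem blockDet_zero_right {d : ℕ} (v : ℕ → Fin d → K) (a i i' : ℕ) :
    blockDet v a i 0 = blockDet v a i' 0 :=
  blockDet_congr fun p hp => by congr 1; grind

/-- A determinant as a linear form in its last row. -/
theorem exists_linearMap_det_last {n : ℕ} (f : Fin (n + 1) → Fin (n + 1) → K) :
    ∃ φ : (Fin (n + 1) → K) →ₗ[K] K,
      ∀ x, φ x = Matrix.det (Matrix.of (Function.update f (Fin.last n) x)) :=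
  ⟨(Matrix.detRowAlternating (n := Fin (n + 1)) (R := K)).toMultilinearMap.toLinearMap
      f (Fin.last n), fun _ => rfl⟩

/-- If all `blockDet v 0 i j` are nonzero, then the next vector can be chosen so that the
`blockDet v 0 i (j + 1)` take prescribed values. -/
theorem exists_next_vector {n : ℕ} (v : ℕ → Fin (n + 1) → K) (j : ℕ)
    (hv : ∀ i ≤ n, blockDet v 0 (i + 1) j ≠ 0) (t : ℕ → K) :
    ∃ x, ∀ i ≤ n, blockDet (Function.update v (n + 1 + j) x) 0 i (j + 1) = t i := by
  let f : ℕ → Fin (n + 1) → Fin (n + 1) → K := fun i p =>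
    v (0 + p + if (p : ℕ) < i then 0 else j + 1)
  choose φ hφ using fun i => exists_linearMap_det_last (f i)
  have h1 : ∀ i ≤ n, ∀ x,
      blockDet (Function.update v (n + 1 + j) x) 0 i (j + 1) = φ i x := by
    intro i hi x
    rw [hφ]
    unfold blockDet
    congr 2
    funext p
    refine Fin.lastCases ?_ (fun p => ?_) p
    · rw [Function.update_self]
      have e : (0 + (Fin.last n : ℕ) + if (Fin.last n : ℕ) < i then 0 else j + 1) =
          n + 1 + j := by
        rw [Fin.val_last]
        grind
      rw [e, Function.update_self]
    · rw [Function.update_of_ne (Fin.castSucc_lt_last p).ne, Function.update_of_ne]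
      have := p.2
      simp only [Fin.val_castSucc]
      grind
  have h2 : ∀ i ≤ n, ∀ l < i, φ i (v l) = 0 := by
    intro i hi l hl
    rw [hφ]
    refine Matrix.det_zero_of_row_eq (i := ⟨l, by omega⟩) (j := Fin.last n)
      (by simp [Fin.ext_iff]; omega) ?_
    have e : Function.update (f i) (Fin.last n) (v l) ⟨l, by omega⟩ =
        Function.update (f i) (Fin.last n) (v l) (Fin.last n) := by
      rw [Function.update_self, Function.update_of_ne (by simp [Fin.ext_iff]; omega)]
      simp [f, hl]
    exact e
  have h3 : ∀ i ≤ n, φ i (v i) ≠ 0 := by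
    intro i hi h
    apply hv i hi
    rw [hφ] at h
    let g : Fin n → Fin (n + 1) → K := fun m => v (m + if (m : ℕ) < i then 0 else j + 1)
    rw [det_eq_neg_one_pow_mul_det_cons _ (Fin.last n) (v i) g (by simp)] at h
    · have h' := (mul_eq_zero.mp h).resolve_left (pow_ne_zero _ (by simp))
      unfold blockDet
      rw [det_eq_neg_one_pow_mul_det_cons _ ⟨i, by omega⟩ (v i) g (by simp), h', mul_zero]
      intro m
      simp only [g, Fin.succAbove, Fin.lt_def, Fin.val_castSucc]
      congr 1
      split_ifs <;> simp at * <;> omega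
    · intro m
      rw [Fin.succAbove_last, Function.update_of_ne (Fin.castSucc_lt_last m).ne]
      simp [f, g]
  suffices h : ∀ m ≤ n + 1, ∃ x, ∀ i ≤ n, n + 1 ≤ i + m → φ i x = t i by
    obtain ⟨x, hx⟩ := h (n + 1) le_rfl
    exact ⟨x, fun i hi => by rw [h1 i hi, hx i hi (by omega)]⟩
  intro m
  induction m with
  | zero => exact fun _ => ⟨0, fun i hi h => by omega⟩
  | succ m ih =>
    intro hm
    obtain ⟨x, hx⟩ := ih (by omega)
    obtain ⟨l, hl⟩ : ∃ l, l + m = n := ⟨n - m, by omega⟩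
    refine ⟨x + ((t l - φ l x) / φ l (v l)) • v l, fun i hi h => ?_⟩
    rw [map_add, map_smul, smul_eq_mul]
    rcases (show l ≤ i by omega).eq_or_lt with rfl | hlt
    · rw [div_mul_cancel₀ _ (h3 _ hi)]
      ring
    · rw [h2 i hi l hlt, hx i hi (by omega)]
      ring

/-- Every array of values without zeros and minus ones is realised by block determinants. -/
theorem exists_blockDet_eq {n : ℕ} (k : ℕ) (y : ℕ → ℕ → K) (hy : ∀ i ≤ n, ∀ j < k, y i j ≠ 0)
    (hy' : ∀ i ≤ n, ∀ j < k, 1 + y i j ≠ 0) :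
    ∃ v : ℕ → Fin (n + 2) → K,
      (∀ i ≤ n + 2, ∀ j ≤ k + 1, blockDet v 0 i j ≠ 0) ∧
      (∀ i ≤ n + 2, ∀ j ≤ k, blockDet v 1 i j ≠ 0) ∧
      ∀ i ≤ n, ∀ j < k, y i j * (blockDet v 0 (i + 1) (j + 2) * blockDet v 1 (i + 1) j) =
        blockDet v 0 (i + 2) (j + 1) * blockDet v 1 i (j + 1) := by
  induction k with
  | zero =>
    let v₀ : ℕ → Fin (n + 2) → K := fun m p => if m = p then 1 else 0
    have h₀ : ∀ i, blockDet v₀ 0 i 0 ≠ 0 := by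
      intro i
      have : blockDet v₀ 0 i 0 = 1 := by
        rw [← Matrix.det_one (n := Fin (n + 2)) (R := K)]
        unfold blockDet
        congr 1
        ext p q
        simp [v₀, Matrix.one_apply, Fin.ext_iff]
      rw [this]
      exact one_ne_zero
    obtain ⟨x, hx⟩ := exists_next_vector v₀ 0 (fun i _ => h₀ _) fun _ => 1
    set v := Function.update v₀ (n + 1 + 1 + 0) x with hvdef
    have hv : ∀ i, blockDet v 0 i 0 ≠ 0 := by
      intro i
      rw [blockDet_congr_left (w := v₀)]
      · exact h₀ i
      · intro m hm
        rw [hvdef, Function.update_of_ne (by omega)]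
    have h1 : ∀ i ≤ n + 2, blockDet v 0 i 1 ≠ 0 := by
      intro i hi
      rcases (show i ≤ n + 1 ∨ i = n + 2 by omega) with h | rfl
      · rw [hx i h]
        exact one_ne_zero
      · rw [blockDet_full v 0 1 0]
        exact hv _
    refine ⟨v, fun i hi j hj => ?_, fun i hi j hj => ?_, fun i _ j hj => by omega⟩
    · rcases (show j = 0 ∨ j = 1 by omega) with rfl | rfl
      · exact hv i
      · exact h1 i hi
    · obtain rfl : j = 0 := by omega
      have := h1 0 (by omega)
      rwa [blockDet_zero_left, blockDet_zero_right v _ _ i, zero_add] at this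
  | succ k ih =>
    obtain ⟨w, hw0, hw1, hwy⟩ := ih (fun i hi j hj => hy i hi j (by omega)) fun i hi j hj =>
      hy' i hi j (by omega)
    -- the values of `blockDet 1 i (k + 1)`
    let s : ℕ → K := fun i => Nat.rec 1 (fun i s =>
      (1 + y i k) * (blockDet w 0 (i + 2) (k + 1) * s / y i k) / blockDet w 0 (i + 1) (k + 1)) i
    let t : ℕ → K := fun i => Nat.casesOn i 1 fun i =>
      blockDet w 0 (i + 2) (k + 1) * s i / (y i k * blockDet w 1 (i + 1) k)
    have hs : ∀ i ≤ n + 1, s i ≠ 0 := by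
      intro i
      induction i with
      | zero => exact fun _ => one_ne_zero
      | succ i ih =>
        intro hi
        exact div_ne_zero (mul_ne_zero (hy' _ (by omega) _ (by omega)) (div_ne_zero (mul_ne_zero
          (hw0 _ (by omega) _ le_rfl) (ih (by omega))) (hy _ (by omega) _ (by omega)))) (hw0 _ (by omega) _ le_rfl)
    have ht : ∀ i ≤ n + 1, t i ≠ 0 := by
      intro i hi
      cases i with
      | zero => exact one_ne_zero
      | succ i =>
        exact div_ne_zero (mul_ne_zero (hw0 _ (by omega) _ le_rfl) (hs _ (by omega)))
          (mul_ne_zero (hy _ (by omega) _ (by omega)) (hw1 _ (by omega) _ le_rfl))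
    obtain ⟨x, hx⟩ := exists_next_vector w (k + 1)
      (fun i hi => hw0 (i + 1) (by omega) _ le_rfl) t
    set v := Function.update w (n + 1 + 1 + (k + 1)) x with hvdef
    have hvw : ∀ m, m < n + 1 + 1 + (k + 1) → v m = w m := by
      intro m hm
      rw [hvdef, Function.update_of_ne (by omega)]
    have e0 : ∀ i, ∀ j ≤ k + 1, blockDet v 0 i j = blockDet w 0 i j := fun i j hj =>
      blockDet_congr_left fun m hm => hvw m (by omega)
    have e1 : ∀ i, ∀ j ≤ k, blockDet v 1 i j = blockDet w 1 i j := fun i j hj =>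
      blockDet_congr_left fun m hm => hvw m (by omega)
    have e1' : ∀ i ≤ n + 1, blockDet v 1 i (k + 1) = s i := by
      intro i
      induction i with
      | zero =>
        intro _
        have h : blockDet v 1 0 (k + 1) = blockDet v 0 0 (k + 2) := by
          rw [blockDet_zero_left, blockDet_zero_left]
          congr 1
          omega
        rw [h]
        exact hx 0 (by omega)
      | succ i ih =>
        intro hi
        have h := blockDet_mul_blockDet v 0 k (i := i) (by omega)
        rw [zero_add, ih (by omega), hx (i + 1) (by omega), e0 _ _ le_rfl, e0 _ _ le_rfl,
          e1 _ _ le_rfl] at h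
        have n0 := hw0 (i + 1) (by omega) (k + 1) le_rfl
        have n1 := hw1 (i + 1) (by omega) k le_rfl
        have ny := hy i (by omega) k (by omega)
        change _ = (1 + y i k) * (blockDet w 0 (i + 2) (k + 1) * s i / y i k) /
          blockDet w 0 (i + 1) (k + 1)
        change _ = _ + blockDet w 0 (i + 2) (k + 1) * s i / (y i k * blockDet w 1 (i + 1) k) *
          _ at h
        rw [eq_div_iff n0, mul_comm, h]
        field_simp
        ring
    refine ⟨v, fun i hi j hj => ?_, fun i hi j hj => ?_, fun i hi j hj => ?_⟩
    · rcases (show j ≤ k + 1 ∨ j = k + 2 by omega) with h | rfl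
      · rw [e0 _ _ h]
        exact hw0 i hi j h
      · rcases (show i ≤ n + 1 ∨ i = n + 2 by omega) with h | rfl
        · rw [hx i h]
          exact ht i h
        · rw [blockDet_full v 0 _ 0, e0 _ _ (by omega)]
          exact hw0 _ le_rfl _ (by omega)
    · rcases (show j ≤ k ∨ j = k + 1 by omega) with h | rfl
      · rw [e1 _ _ h]
        exact hw1 i hi j h
      · rcases (show i ≤ n + 1 ∨ i = n + 2 by omega) with h | rfl
        · rw [e1' i h]
          exact hs i h
        · rw [blockDet_full v 1 _ 0, e1 _ _ (by omega)]
          exact hw1 _ le_rfl _ (by omega)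
    · rcases (show j < k ∨ j = k by omega) with h | rfl
      · rw [e0 _ _ (by omega), e1 _ _ (by omega), e0 _ _ (by omega), e1 _ _ (by omega)]
        exact hwy i hi j h
      · rw [show blockDet v 0 (i + 1) (j + 2) = t (i + 1) from hx _ (by omega),
          e1 _ _ le_rfl, e0 _ _ le_rfl, e1' _ (by omega)]
        change y i j * (blockDet w 0 (i + 2) (j + 1) * s i / (y i j * blockDet w 1 (i + 1) j) *
          _) = _
        have n1 := hw1 (i + 1) (by omega) j le_rfl
        have ny := hy i hi j (by omega)
        field_simp

/-- A nonvanishing slice of block determinants that matches a solution of the `Y`-system propagates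
to all later times. -/
theorem blockDet_propagate {n k : ℕ} (v : ℕ → Fin (n + 2) → K)
    (hv : ∀ m, v (m + (n + 1 + k + 2)) = (-1 : K) ^ (n + 1) • v m) (y P Q : ℕ → ℕ → ℕ → K)
    (hy : ∀ a, ∀ i ≤ n, ∀ j < k, y a i j ≠ 0)
    (hy' : ∀ a, ∀ i ≤ n, ∀ j < k, 1 + y a i j ≠ 0)
    (hP : ∀ a, ∀ i ≤ n, ∀ j < k, P a (i + 1) (j + 1) = 1 + y a i j)
    (hP0 : ∀ a j, P a 0 j = 1) (hP1 : ∀ a j, P a (n + 2) j = 1)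
    (hQ : ∀ a, ∀ i ≤ n, ∀ j < k, Q a (i + 1) (j + 1) = 1 + 1 / y a i j)
    (hQ0 : ∀ a i, Q a i 0 = 1) (hQ1 : ∀ a i, Q a i (k + 1) = 1)
    (hY : ∀ a, ∀ i ≤ n, ∀ j < k, y a i j * y (a + 1) i j =
      (P (a + 1) i (j + 1) * P a (i + 2) (j + 1)) / (Q a (i + 1) (j + 2) * Q (a + 1) (i + 1) j))
    (h0 : ∀ i ≤ n + 2, ∀ j ≤ k + 1, blockDet v 0 i j ≠ 0)
    (h1 : ∀ i ≤ n + 2, ∀ j ≤ k, blockDet v 1 i j ≠ 0)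
    (hm : ∀ i ≤ n, ∀ j < k,
      y 0 i j * (blockDet v 0 (i + 1) (j + 2) * blockDet v 1 (i + 1) j) =
        blockDet v 0 (i + 2) (j + 1) * blockDet v 1 i (j + 1)) (a : ℕ) :
    (∀ i ≤ n + 2, ∀ j ≤ k + 1, blockDet v a i j ≠ 0) ∧
      (∀ i ≤ n + 2, ∀ j ≤ k + 1, blockDet v (a + 1) i j ≠ 0) ∧
      ∀ i ≤ n, ∀ j < k,
        y a i j * (blockDet v a (i + 1) (j + 2) * blockDet v (a + 1) (i + 1) j) =
          blockDet v a (i + 2) (j + 1) * blockDet v (a + 1) i (j + 1) := by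
  let T := blockDet v
  -- on the boundary the block determinants are determinants of consecutive vectors
  let W : ℕ → K := fun m => T m 0 0
  have b0 : ∀ a j, T a 0 j = W (a + j) := fun a j => by
    change blockDet v a 0 j = blockDet v (a + j) 0 0
    rw [blockDet_zero_left, blockDet_zero_right]
  have b1 : ∀ a j, T a (n + 2) j = W a := fun a j => by
    change blockDet v a (n + 2) j = blockDet v a 0 0
    rw [blockDet_full v a j 0, blockDet_zero_right]
  have b2 : ∀ a i, T a i 0 = W a := fun a i => blockDet_zero_right _ _ _ _
  have b3 : ∀ a, ∀ i ≤ n + 2, T a i (k + 1) = W (a + i + k + 1) := fun a i hi => by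
    change blockDet v a i (k + 1) = blockDet v (a + i + (k + 1)) 0 0
    obtain ⟨i', hi'⟩ := Nat.exists_eq_add_of_le hi
    rw [blockDet_twist v hv a hi'.symm (add_zero _), blockDet_zero_right]
  have hW : ∀ m, W m ≠ 0 := by
    intro m
    induction m using Nat.strong_induction_on with
    | _ m ih =>
      rcases lt_or_ge m (n + k + 3) with h | h
      · rcases le_or_gt m (k + 1) with h' | h'
        · have := h0 0 (by omega) m h'
          rwa [show blockDet v 0 0 m = W m by rw [← zero_add m, ← b0, zero_add]] at this
        · obtain ⟨i, rfl⟩ := Nat.exists_eq_add_of_lt h'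
          have := h0 (i + 1) (by omega) (k + 1) le_rfl
          rw [show blockDet v 0 (i + 1) (k + 1) = _ from b3 _ _ (by omega)] at this
          convert this using 2
          ring
      · obtain ⟨m, rfl⟩ := Nat.exists_eq_add_of_le' h
        have := ih m (by omega)
        rw [← b1 m (k + 1), b3 _ _ le_rfl] at this
        convert this using 2
        ring
  have hir : ∀ a, ∀ i ≤ n, ∀ j, T a (i + 1) (j + 1) * T (a + 1) (i + 1) (j + 1) =
      T a (i + 2) (j + 1) * T (a + 1) i (j + 1) + T a (i + 1) (j + 2) * T (a + 1) (i + 1) j :=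
    fun a i hi j => blockDet_mul_blockDet v a j (by omega)
  let M : ℕ → ℕ → ℕ → Prop := fun a i j =>
    y a i j * (T a (i + 1) (j + 2) * T (a + 1) (i + 1) j) = T a (i + 2) (j + 1) * T (a + 1) i (j + 1)
  have hPT : ∀ a, ∀ i ≤ n + 2, ∀ j < k, (∀ i', i = i' + 1 → i' ≤ n → M a i' j) →
      P a i (j + 1) * (T a i (j + 2) * T (a + 1) i j) = T a i (j + 1) * T (a + 1) i (j + 1) := by
    intro a i hi j hj h
    rcases (show i = 0 ∨ i = n + 2 ∨ ∃ i', i = i' + 1 ∧ i' ≤ n by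
      rcases i with _ | i
      · simp
      · rcases (show i = n + 1 ∨ i ≤ n by omega) with h | h
        · simp [h]
        · exact Or.inr (Or.inr ⟨i, rfl, h⟩)) with rfl | rfl | ⟨i, rfl, hi'⟩
    · rw [hP0, b0, b0, b0, b0, show a + 1 + j = a + (j + 1) by ring,
        show a + 1 + (j + 1) = a + (j + 2) by ring]
      ring
    · rw [hP1, b1, b1, b1, b1, one_mul]
    · have h' : _ = _ := h i rfl hi'
      rw [hP a i hi' j hj, hir a i hi' j, ← h']
      ring
  have hQT : ∀ a, ∀ i ≤ n, ∀ j ≤ k + 1, (∀ j', j = j' + 1 → j' < k → M a i j') →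
      Q a (i + 1) j * (T a (i + 2) j * T (a + 1) i j) = T a (i + 1) j * T (a + 1) (i + 1) j := by
    intro a i hi j hj h
    rcases (show j = 0 ∨ j = k + 1 ∨ ∃ j', j = j' + 1 ∧ j' < k by
      rcases j with _ | j
      · simp
      · rcases (show j = k ∨ j < k by omega) with h | h
        · simp [h]
        · exact Or.inr (Or.inr ⟨j, rfl, h⟩)) with rfl | rfl | ⟨j, rfl, hj'⟩
    · rw [hQ0, b2, b2, b2, b2, one_mul]
    · rw [hQ1, b3 _ _ (by omega), b3 _ _ (by omega), b3 _ _ (by omega), b3 _ _ (by omega),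
        show a + 1 + i + k + 1 = a + (i + 1) + k + 1 by ring,
        show a + 1 + (i + 1) + k + 1 = a + (i + 2) + k + 1 by ring]
      ring
    · have h' : _ = _ := h j rfl hj'
      rw [hQ a i hi j hj', hir a i hi j, ← h']
      have := hy a i hi j hj'
      field_simp
  change (∀ i ≤ n + 2, ∀ j ≤ k + 1, T a i j ≠ 0) ∧
      (∀ i ≤ n + 2, ∀ j ≤ k + 1, T (a + 1) i j ≠ 0) ∧ ∀ i ≤ n, ∀ j < k, M a i j
  induction a with
  | zero =>
    refine ⟨h0, fun i hi j hj => ?_, hm⟩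
    rcases (show j ≤ k ∨ j = k + 1 by omega) with h | rfl
    · exact h1 i hi j h
    · rw [b3 _ _ hi]
      exact hW _
  | succ a ih =>
    obtain ⟨hA, hB, hM⟩ := ih
    have main : ∀ i ≤ n + 2, ∀ j ≤ k + 1, T (a + 2) i j ≠ 0 ∧
        ∀ i' j', i = i' + 1 → j = j' + 1 → i' ≤ n → j' < k → M (a + 1) i' j' := by
      intro i
      induction i with
      | zero =>
        refine fun _ j _ => ⟨?_, fun i' j' h => by omega⟩
        rw [b0]
        exact hW _
      | succ i ihi =>
        intro hi j
        induction j with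
        | zero =>
          refine fun _ => ⟨?_, fun i' j' _ h => by omega⟩
          rw [b2]
          exact hW _
        | succ j ihj =>
          intro hj
          rcases (show i = n + 1 ∨ i ≤ n by omega) with rfl | hi'
          · refine ⟨?_, fun i' j' h => by omega⟩
            rw [b1]
            exact hW _
          rcases (show j = k ∨ j < k by omega) with rfl | hj'
          · refine ⟨?_, fun i' j' _ h => by omega⟩
            rw [b3 _ _ hi]
            exact hW _
          have c1 := (ihi (by omega) j (by omega)).1
          have c3 := (ihj (by omega)).1
          have p1 := hPT (a + 1) i (by omega) j hj' fun i' h h' =>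
            (ihi (by omega) (j + 1) (by omega)).2 i' j h rfl h' hj'
          have p2 := hPT a (i + 2) (by omega) j hj' fun i' _ h' => hM i' h' j hj'
          have q1 := hQT a i hi' (j + 2) (by omega) fun j' _ h' => hM i hi' j' h'
          have q2 := hQT (a + 1) i hi' j (by omega) fun j' h h' =>
            (ihj (by omega)).2 i j' rfl h hi' h'
          have m0 : _ = _ := hM i hi' j hj'
          have hm1 : M (a + 1) i j := by
            have a1 := hA (i + 1) (by omega) (j + 2) (by omega)
            have a2 := hA (i + 2) (by omega) (j + 1) (by omega)
            have a3 := hA (i + 2) (by omega) (j + 2) (by omega)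
            have b1 := hB (i + 1) (by omega) j (by omega)
            have b2 := hB i (by omega) (j + 1) (by omega)
            have b3 := hB i (by omega) (j + 2) (by omega)
            have b4 := hB (i + 2) (by omega) j (by omega)
            have b5 := hB (i + 1) (by omega) (j + 2) (by omega)
            have eq := hY a i hi' j hj'
            rw [← eq_div_iff (mul_ne_zero ‹_› ‹_›)] at p1 p2 q1 q2 m0
            rw [p1, p2, q1, q2, m0] at eq
            change y (a + 1) i j * (T (a + 1) (i + 1) (j + 2) * T (a + 2) (i + 1) j) =
              T (a + 1) (i + 2) (j + 1) * T (a + 2) i (j + 1)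
            generalize T a (i + 1) (j + 2) = A1 at *
            generalize T a (i + 2) (j + 1) = A2 at *
            generalize T a (i + 2) (j + 2) = A3 at *
            generalize T (a + 1) (i + 1) j = B1 at *
            field_simp at eq
            linear_combination eq
          refine ⟨?_, ?_⟩
          · have h := hir (a + 1) i hi' j
            have hm1' : _ = _ := hm1
            rw [← hm1', ← add_one_mul, add_comm (y (a + 1) i j)] at h
            have := hB (i + 1) (by omega) (j + 2) (by omega)
            intro h'
            rw [show T (a + 1 + 1) (i + 1) (j + 1) = 0 from h', mul_zero] at h
            exact mul_ne_zero (hy' _ _ hi' _ hj') (mul_ne_zero this c3) h.symm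
          · rintro _ _ ⟨rfl⟩ ⟨rfl⟩ _ _
            exact hm1
    exact ⟨hB, fun i hi j hj => (main i hi j hj).1, fun i hi j hj =>
      (main (i + 1) (by omega) (j + 1) (by omega)).2 i j rfl rfl hi hj⟩

/-- The half-periodicity of the `Y`-system in light-cone coordinates. -/
theorem half_periodic_of_lightCone {n k : ℕ} (y P Q : ℕ → ℕ → ℕ → K)
    (hy : ∀ a, ∀ i ≤ n, ∀ j < k, y a i j ≠ 0)
    (hy' : ∀ a, ∀ i ≤ n, ∀ j < k, 1 + y a i j ≠ 0)
    (hP : ∀ a, ∀ i ≤ n, ∀ j < k, P a (i + 1) (j + 1) = 1 + y a i j)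
    (hP0 : ∀ a j, P a 0 j = 1) (hP1 : ∀ a j, P a (n + 2) j = 1)
    (hQ : ∀ a, ∀ i ≤ n, ∀ j < k, Q a (i + 1) (j + 1) = 1 + 1 / y a i j)
    (hQ0 : ∀ a i, Q a i 0 = 1) (hQ1 : ∀ a i, Q a i (k + 1) = 1)
    (hY : ∀ a, ∀ i ≤ n, ∀ j < k, y a i j * y (a + 1) i j =
      (P (a + 1) i (j + 1) * P a (i + 2) (j + 1)) / (Q a (i + 1) (j + 2) * Q (a + 1) (i + 1) j))
    {i i' j j' : ℕ} (hi : i + i' = n) (hj : j + j' + 1 = k) :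
    y 0 i j = y (i + j + 2) i' j' := by
  obtain ⟨w, h0, h1, hm⟩ := exists_blockDet_eq (n := n) k (y 0) (hy 0) (hy' 0)
  let N := n + 1 + k + 2
  let v : ℕ → Fin (n + 2) → K := fun m => ((-1 : K) ^ (n + 1)) ^ (m / N) • w (m % N)
  have hv : ∀ m, v (m + N) = (-1 : K) ^ (n + 1) • v m := by
    intro m
    simp only [v]
    rw [Nat.add_mod_right, Nat.add_div_right _ (by omega), pow_succ', mul_smul]
  have hvw : ∀ m < N, v m = w m := by
    intro m hm
    simp only [v]
    rw [Nat.mod_eq_of_lt hm, Nat.div_eq_of_lt hm, pow_zero, one_smul]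
  have e0 : ∀ i, ∀ j ≤ k + 1, blockDet v 0 i j = blockDet w 0 i j := fun i j hj =>
    blockDet_congr_left fun m hm => hvw m (by omega)
  have e1 : ∀ i, ∀ j ≤ k, blockDet v 1 i j = blockDet w 1 i j := fun i j hj =>
    blockDet_congr_left fun m hm => hvw m (by omega)
  have prop := blockDet_propagate v hv y P Q hy hy' hP hP0 hP1 hQ hQ0 hQ1 hY
    (fun i hi j hj => by rw [e0 _ _ hj]; exact h0 i hi j hj)
    (fun i hi j hj => by rw [e1 _ _ hj]; exact h1 i hi j hj)
    (fun i hi j hj => by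
      rw [e0 _ _ (by omega), e0 _ _ (by omega), e1 _ _ (by omega), e1 _ _ (by omega)]
      exact hm i hi j hj)
  obtain ⟨hA, hB, hM⟩ := prop 0
  have h := hM i (by omega) j (by omega)
  have h' := (prop (i + j + 2)).2.2 i' (by omega) j' (by omega)
  have t1 := blockDet_twist v hv 0 (i := i + 1) (i' := i' + 1) (j := j + 2) (j' := j')
    (by omega) (by omega)
  have t2 := blockDet_twist v hv 1 (i := i + 1) (i' := i' + 1) (j := j) (j' := j' + 2)
    (by omega) (by omega)
  have t3 := blockDet_twist v hv 0 (i := i + 2) (i' := i') (j := j + 1) (j' := j' + 1)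
    (by omega) (by omega)
  have t4 := blockDet_twist v hv 1 (i := i) (i' := i' + 2) (j := j + 1) (j' := j' + 1)
    (by omega) (by omega)
  rw [show 0 + (i + 1) + (j + 2) = i + j + 2 + 1 by ring] at t1
  rw [show 1 + (i + 1) + j = i + j + 2 by ring] at t2
  rw [show 0 + (i + 2) + (j + 1) = i + j + 2 + 1 by ring] at t3
  rw [show 1 + i + (j + 1) = i + j + 2 by ring] at t4
  rw [← t1, ← t2, ← t3, ← t4, mul_comm (blockDet v 1 _ _), mul_comm (blockDet v 1 _ _),
    ← h] at h'
  exact (mul_right_cancel₀ (mul_ne_zero (hA _ (by omega) _ (by omega))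
    (hB _ (by omega) _ (by omega))) h').symm

end Determinants

theorem onePlus_of_mem {r k : ℕ} (Y : truncatedLattice r k → ℂˣ) {m : ℤ × ℤ × ℤ}
    (h : m ∈ truncatedLattice r k) : onePlus Y m = 1 + (Y ⟨m, h⟩ : ℂ) :=
  dif_pos h

theorem onePlus_of_notMem {r k : ℕ} (Y : truncatedLattice r k → ℂˣ) {m : ℤ × ℤ × ℤ}
    (h : m ∉ truncatedLattice r k) : onePlus Y m = 1 :=
  dif_neg h

theorem onePlusInv_of_mem {r k : ℕ} (Y : truncatedLattice r k → ℂˣ) {m : ℤ × ℤ × ℤ}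
    (h : m ∈ truncatedLattice r k) : onePlusInv Y m = 1 + 1 / (Y ⟨m, h⟩ : ℂ) :=
  dif_pos h

theorem onePlusInv_of_notMem {r k : ℕ} (Y : truncatedLattice r k → ℂˣ) {m : ℤ × ℤ × ℤ}
    (h : m ∉ truncatedLattice r k) : onePlusInv Y m = 1 :=
  dif_neg h

theorem IsSolution.factors_ne_zero {r k : ℕ} {Y : truncatedLattice r k → ℂˣ} (hY : IsSolution Y)
    {n i j : ℤ} (h : (n, i, j) ∈ truncatedLattice r k) :
    (onePlus Y (n, i - 1, j) ≠ 0 ∧ onePlus Y (n, i + 1, j) ≠ 0) ∧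
      onePlusInv Y (n, i, j + 1) ≠ 0 ∧ onePlusInv Y (n, i, j - 1) ≠ 0 := by
  have h' := mul_ne_zero (Y ⟨(n - 1, i, j), truncatedLattice_change h (n - 1)⟩).ne_zero
    (Y ⟨(n + 1, i, j), truncatedLattice_change h (n + 1)⟩).ne_zero
  rw [hY n i j h] at h'
  simpa [not_or] using h'

/-- Unless `r = k = 1`, a solution never takes the value `-1`. -/
theorem IsSolution.one_add_ne_zero {r k : ℕ} {Y : truncatedLattice r k → ℂˣ} (hY : IsSolution Y)
    (hrk : ¬(r = 1 ∧ k = 1)) {m : ℤ × ℤ × ℤ} (h : m ∈ truncatedLattice r k) :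
    1 + (Y ⟨m, h⟩ : ℂ) ≠ 0 := by
  obtain ⟨n, i, j⟩ := m
  have h' := h
  simp only [truncatedLattice, Set.mem_ofPred_eq] at h'
  have inv : onePlusInv Y (n, i, j) ≠ 0 → 1 + (Y ⟨(n, i, j), h⟩ : ℂ) ≠ 0 := by
    rw [onePlusInv_of_mem Y h]
    intro h1 h2
    apply h1
    field_simp
    rw [add_comm, h2, mul_zero]
  rw [← onePlus_of_mem Y h] at inv ⊢
  rcases (show (2 ≤ i ∨ i + 1 ≤ r) ∨ 2 ≤ j ∨ j + 1 ≤ k by omega) with (h1 | h1) | h1 | h1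
  · have := (hY.factors_ne_zero (n := n) (i := i - 1) (j := j)
      (by simp only [truncatedLattice, Set.mem_ofPred_eq]; omega)).1.2
    rwa [sub_add_cancel] at this
  · have := (hY.factors_ne_zero (n := n) (i := i + 1) (j := j)
      (by simp only [truncatedLattice, Set.mem_ofPred_eq]; omega)).1.1
    rwa [add_sub_cancel_right] at this
  · have := (hY.factors_ne_zero (n := n) (i := i) (j := j - 1)
      (by simp only [truncatedLattice, Set.mem_ofPred_eq]; omega)).2.1
    rw [sub_add_cancel] at this
    exact inv this
  · have := (hY.factors_ne_zero (n := n) (i := i) (j := j + 1)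
      (by simp only [truncatedLattice, Set.mem_ofPred_eq]; omega)).2.2
    rw [add_sub_cancel_right] at this
    exact inv this

theorem mem_truncatedLattice {r k : ℕ} {n i j : ℤ} :
    (n, i, j) ∈ truncatedLattice r k ↔ (1 ≤ i ∧ i ≤ r) ∧ 1 ≤ j ∧ j ≤ k :=
  Iff.rfl

theorem coord_congr {r k : ℕ} (Y : truncatedLattice r k → ℂˣ) {m m' : ℤ × ℤ × ℤ} (e : m = m')
    (h : m ∈ truncatedLattice r k) (h' : m' ∈ truncatedLattice r k) : Y ⟨m, h⟩ = Y ⟨m', h'⟩ := by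
  subst e
  rfl

theorem IsSolution.half_periodic_of_one_one {Y : truncatedLattice 1 1 → ℂˣ} (hY : IsSolution Y)
    {n : ℤ} (h : ∀ n' : ℤ, (n', 1, 1) ∈ truncatedLattice 1 1) :
    Y ⟨(n, 1, 1), h n⟩ = Y ⟨(n + 4, 1, 1), h (n + 4)⟩ := by
  have key : ∀ m : ℤ, (Y ⟨(m - 1, 1, 1), h _⟩ : ℂ) * (Y ⟨(m + 1, 1, 1), h _⟩ : ℂ) = 1 := by
    intro m
    have := hY m 1 1 (h m)
    rwa [onePlus_of_notMem, onePlus_of_notMem, onePlusInv_of_notMem, onePlusInv_of_notMem,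
      mul_one, div_one] at this <;> simp [mem_truncatedLattice]
  have k1 := key (n + 1)
  have k2 := key (n + 3)
  rw [coord_congr Y (m' := (n, 1, 1)) (by simp) _ (h _),
    coord_congr Y (m' := (n + 2, 1, 1)) (by simp; ring) (h (n + 1 + 1)) (h _)] at k1
  rw [coord_congr Y (m' := (n + 2, 1, 1)) (by simp; ring) (h (n + 3 - 1)) (h _),
    coord_congr Y (m' := (n + 4, 1, 1)) (by simp; ring) (h (n + 3 + 1)) (h _), mul_comm] at k2
  exact Units.ext (mul_right_cancel₀ (Units.ne_zero _) (k1.trans k2.symm))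

theorem IsSolution.half_periodic {r k : ℕ} {Y : truncatedLattice r k → ℂˣ} (hY : IsSolution Y)
    (n i j : ℤ) (h : (n, i, j) ∈ truncatedLattice r k) :
    Y ⟨(n, i, j), h⟩ = Y ⟨(n + r + k + 2, (r : ℤ) + 1 - i, (k : ℤ) + 1 - j),
      truncatedLattice_twist h (n + r + k + 2)⟩ := by
  by_cases hrk : r = 1 ∧ k = 1
  · obtain ⟨rfl, rfl⟩ := hrk
    have h' := h
    rw [mem_truncatedLattice] at h'
    obtain rfl : i = 1 := by omega
    obtain rfl : j = 1 := by omega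
    rw [hY.half_periodic_of_one_one fun n' => truncatedLattice_change h n']
    exact coord_congr Y (by simp; ring) _ _
  have h' := h
  rw [mem_truncatedLattice] at h'
  obtain ⟨r, rfl⟩ : ∃ r', r = r' + 1 := ⟨r - 1, by omega⟩
  obtain ⟨i, rfl⟩ : ∃ i' : ℕ, i = i' + 1 := ⟨(i - 1).toNat, by omega⟩
  obtain ⟨j, rfl⟩ : ∃ j' : ℕ, j = j' + 1 := ⟨(j - 1).toNat, by omega⟩
  obtain ⟨i', hi⟩ : ∃ i', i + i' = r := ⟨r - i, by omega⟩
  obtain ⟨j', hj⟩ : ∃ j', j + j' + 1 = k := ⟨k - 1 - j, by omega⟩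
  let s : ℕ → ℕ → ℕ → ℤ × ℤ × ℤ := fun a p q => (n + 2 * a + p + q - (i + 1) - (j + 1), p, q)
  classical
  let y : ℕ → ℕ → ℕ → ℂ := fun a p q =>
    if h : s a (p + 1) (q + 1) ∈ truncatedLattice (r + 1) k then Y ⟨_, h⟩ else 1
  have hs : ∀ a, ∀ p ≤ r, ∀ q < k, s a (p + 1) (q + 1) ∈ truncatedLattice (r + 1) k := by
    intro a p hp q hq
    simp only [s, mem_truncatedLattice]
    omega
  have hy : ∀ a p (hp : p ≤ r) q (hq : q < k), y a p q = Y ⟨_, hs a p hp q hq⟩ :=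
    fun a p hp q hq => dif_pos (hs a p hp q hq)
  have main := half_periodic_of_lightCone (n := r) (k := k) y
    (fun a p q => onePlus Y (s a p q)) (fun a p q => onePlusInv Y (s a p q))
    (fun a p hp q hq => by rw [hy a p hp q hq]; exact Units.ne_zero _)
    (fun a p hp q hq => by rw [hy a p hp q hq]; exact hY.one_add_ne_zero hrk _)
    (fun a p hp q hq => by rw [hy a p hp q hq]; exact onePlus_of_mem Y _)
    (fun a q => onePlus_of_notMem Y (by simp [s, mem_truncatedLattice]))
    (fun a q => onePlus_of_notMem Y (by simp only [s, mem_truncatedLattice]; omega))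
    (fun a p hp q hq => by rw [hy a p hp q hq]; exact onePlusInv_of_mem Y _)
    (fun a q => onePlusInv_of_notMem Y (by simp [s, mem_truncatedLattice]))
    (fun a q => onePlusInv_of_notMem Y (by simp only [s, mem_truncatedLattice]; omega))
    (fun a p hp q hq => by
      have hm : (n + 2 * a + p + q - i - j + 1, ((p + 1 : ℕ) : ℤ), ((q + 1 : ℕ) : ℤ)) ∈
          truncatedLattice (r + 1) k := hs a p hp q hq
      have := hY _ _ _ hm
      rw [hy a p hp q hq, hy (a + 1) p hp q hq]
      have e1 : s (a + 1) p (q + 1) =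
          (n + 2 * a + p + q - i - j + 1, ((p + 1 : ℕ) : ℤ) - 1, ((q + 1 : ℕ) : ℤ)) := by
        simp only [s, Prod.mk.injEq, and_true]
        omega
      have e2 : s a (p + 2) (q + 1) =
          (n + 2 * a + p + q - i - j + 1, ((p + 1 : ℕ) : ℤ) + 1, ((q + 1 : ℕ) : ℤ)) := by
        simp only [s, Prod.mk.injEq, and_true]
        omega
      have e3 : s a (p + 1) (q + 2) =
          (n + 2 * a + p + q - i - j + 1, ((p + 1 : ℕ) : ℤ), ((q + 1 : ℕ) : ℤ) + 1) := by
        simp only [s, Prod.mk.injEq, true_and]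
        omega
      have e4 : s (a + 1) (p + 1) q =
          (n + 2 * a + p + q - i - j + 1, ((p + 1 : ℕ) : ℤ), ((q + 1 : ℕ) : ℤ) - 1) := by
        simp only [s, Prod.mk.injEq, true_and]
        omega
      rw [e1, e2, e3, e4, ← this]
      congr 2
      · refine coord_congr Y ?_ _ _
        simp only [s, Prod.mk.injEq, and_true]
        omega
      · refine coord_congr Y ?_ _ _
        simp only [s, Prod.mk.injEq, and_true]
        omega)
    hi hj
  rw [hy _ _ (by omega) _ (by omega), hy _ _ (by omega) _ (by omega)] at main
  have e1 : s 0 (i + 1) (j + 1) = (n, (i : ℤ) + 1, (j : ℤ) + 1) := by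
    simp only [s, Prod.mk.injEq]
    omega
  have e2 : s (i + j + 2) (i' + 1) (j' + 1) =
      (n + (r + 1 : ℕ) + k + 2, ((r + 1 : ℕ) : ℤ) + 1 - (i + 1), (k : ℤ) + 1 - (j + 1)) := by
    simp only [s, Prod.mk.injEq]
    omega
  rw [coord_congr Y e1 _ h, coord_congr Y e2 _ (truncatedLattice_twist h _)] at main
  exact Units.ext main

end YSystem

theorem theorem1 (r k : ℕ) (Y : YSystem.truncatedLattice r k → ℂˣ)
    (hY : YSystem.IsSolution Y) :
    (∀ (n i j : ℤ) (h : (n, i, j) ∈ YSystem.truncatedLattice r k),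
      Y ⟨(n, i, j), h⟩ =
        Y ⟨(n + r + k + 2, (r : ℤ) + 1 - i, (k : ℤ) + 1 - j),
          YSystem.truncatedLattice_twist h (n + r + k + 2)⟩) ∧
    (∀ (n i j : ℤ) (h : (n, i, j) ∈ YSystem.truncatedLattice r k),
      Y ⟨(n + 2 * ((r : ℤ) + k + 2), i, j),
          YSystem.truncatedLattice_change h (n + 2 * ((r : ℤ) + k + 2))⟩ =
        Y ⟨(n, i, j), h⟩) := by
  refine ⟨hY.half_periodic, fun n i j h => ?_⟩
  rw [hY.half_periodic n i j h, hY.half_periodic _ _ _ (YSystem.truncatedLattice_twist h _)]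
  exact YSystem.coord_congr Y (by ext <;> simp; ring) _ _
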